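/- **Theorem 5.1.** Let $\mathcal A$ be a finitely cocomplete homological category, that is, a category with finite colimits which is pointed, regular and protomodular (the Split Short Five Lemma holds). *Notation.* For objects $X,Y,Z$ let $\iota_{X,Y}\colon X\otimes Y\to X+Y$ be the kernel of the canonical comparison $X+Y\to X\times Y$, and let $\iota_{X,Y,Z}\colon X\otimes Y\otimes Z\to X+Y+Z$ be the kernel of the comparison $X+Y+Z\to (X+Y)\times(X+Z)\times(Y+Z)$ (each component sends one summand to $0$ and includes the other two). The construction $X\otimes Y$ is functorial; $f\otimes g$ is the restriction of $f+g$. For subobjects $k\colon K\to X$, $l\colon L\to X$, $m\colon M\to X$, the commutators $[K,L]\leq X$ and $[K,L,M]\leq X$ are the images of $\langle k,l\rangle\circ\iota_{K,L}\colon K\otimes L\to X$ and $\langle k,l,m\rangle\circ\iota_{K,L,M}\colon K\otimes L\otimes M\to X$, where $\langle\cdots\rangle$ denotes the morphism out of the sum with the given components. Put $c^{X,X}=\langle 1_X,1_X\rangle\circ\iota_{X,X}\colon X\otimes X\to X$. For a normal monomorphism $n\colon N\to X$ the conjugation action of $X$ on $N$ is the unique morphism $c^{N,X}\colon N\otimes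 X\to N$ with $n\circ c^{N,X}=c^{X,X}\circ(n\otimes 1_X)$. For $\psi\colon A\otimes G\to A$ and $h\colon H\to G$ put $h^*(\psi)=\psi\circ(1_A\otimes h)\colon A\otimes H\to A$. *Statement.* Let $(R,G,d,c,e)$ be an internal reflexive graph in $\mathcal A$: morphisms $d,c\colon R\to G$ and $e\colon G\to R$ with $d\circ e=c\circ e=1_G$. Let $A=\mathrm{Ker}(d)$, a normal subobject of $R$. The following are equivalent: 1. $(R,G,d,c,e)$ is an internal category, i.e. there is a composition $m\colon R\times_G R\to R$, defined on the pullback of $d$ and $c$ (pairs $(\beta,\alpha)$ with $d\beta=c\alpha$), satisfying $d\,m(\beta,\alpha)=d\alpha$, $c\,m(\beta,\alpha)=c\beta$, the unit laws with respect to $e$, and associativity; 2. $[\mathrm{Ker}(d),\mathrm{Ker}(c)]=0=[\mathrm{Ker}(d),\mathrm{Ker}(c),R]$; 3. $[\mathrm{Ker}(d),\mathrm{Ker}(c)]=0=[\mathrm{Ker}(d),\mathrm{Ker}(c),\mathrm{Im}(e)]$; 4. the conjugation action $c^{A,R}\colon A\otimes R\to A$ factors through $1_A\otimes c\colon A\otimes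 R\to A\otimes G$; 5. $c^{A,R}=(e\circ c)^*(c^{A,R})$. -/

import Mathlib

open CategoryTheory CategoryTheory.Limits

universe v u

namespace Homological

noncomputable section

/-- A morphism of points (split epimorphisms with a chosen section)
from `s' : G' ⇄ X' : p'` to `s : G ⇄ X : p`. -/
structure PointHom {C : Type u} [Category.{v} C] {X' G' X G : C}
    (p' : X' ⟶ G') (s' : G' ⟶ X') (p : X ⟶ G) (s : G ⟶ X)
    (x : X' ⟶ X) (g : G' ⟶ G) : Prop where
  proj : x ≫ p = p' ≫ g
  sect : s' ≫ x = g ≫ s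

/-- A pointed category with pullbacks is protomodular when the Split Short Five Lemma holds: a
morphism of points `(x, g)` for which `g` and the morphism `a` induced between the kernels of the
split epimorphisms are isomorphisms has `x` an isomorphism. -/
class Protomodular (C : Type u) [Category.{v} C] [HasZeroMorphisms C] [HasKernels C] : Prop where
  splitShortFive : ∀ {X' G' X G : C} (p' : X' ⟶ G') (s' : G' ⟶ X') (p : X ⟶ G) (s : G ⟶ X)
    (x : X' ⟶ X) (g : G' ⟶ G), s' ≫ p' = 𝟙 G' → s ≫ p = 𝟙 G →
    ∀ h : PointHom p' s' p s x g,
      IsIso g → IsIso (kernel.map p' p x g h.proj.symm) → IsIso x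

/-- A homological category: pointed, regular and protomodular. (The zero morphisms are those of
the zero object; `HasZeroMorphisms` is a subsingleton.) -/
class HomologicalCategory (C : Type u) [Category.{v} C] [HasZeroMorphisms C] : Prop
    extends HasZeroObject C, Regular C, Protomodular C

variable {C : Type u} [Category.{v} C] [HasZeroMorphisms C] [HasFiniteColimits C]
  [HomologicalCategory C]

/-- The comparison morphism `X + Y ⟶ X × Y` with matrix `(1, 0; 0, 1)`. -/
def comparison₂ (X Y : C) : X ⨿ Y ⟶ X ⨯ Y :=
  prod.lift (coprod.desc (𝟙 X) 0) (coprod.desc 0 (𝟙 Y))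

/-- The binary co-smash product `X ⊗ Y`: the kernel of `X + Y ⟶ X × Y`. -/
abbrev CoSmash₂ (X Y : C) : C := kernel (comparison₂ X Y)

/-- The kernel inclusion `ι_{X,Y} : X ⊗ Y ⟶ X + Y`. -/
def CoSmash₂.ι (X Y : C) : CoSmash₂ X Y ⟶ X ⨿ Y := kernel.ι (comparison₂ X Y)

/-- The comparison morphism `X + Y + Z ⟶ (X + Y) × (X + Z) × (Y + Z)`, each component of which
kills one summand and includes the other two. -/
def comparison₃ (X Y Z : C) : (X ⨿ Y) ⨿ Z ⟶ (X ⨿ Y) ⨯ ((X ⨿ Z) ⨯ (Y ⨿ Z)) :=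
  prod.lift (coprod.desc (coprod.desc coprod.inl coprod.inr) 0)
    (prod.lift (coprod.desc (coprod.desc coprod.inl 0) coprod.inr)
      (coprod.desc (coprod.desc 0 coprod.inl) coprod.inr))

/-- The ternary co-smash product `X ⊗ Y ⊗ Z`:
the kernel of `X + Y + Z ⟶ (X + Y) × (X + Z) × (Y + Z)`. -/
abbrev CoSmash₃ (X Y Z : C) : C := kernel (comparison₃ X Y Z)

/-- The kernel inclusion `ι_{X,Y,Z} : X ⊗ Y ⊗ Z ⟶ X + Y + Z`. -/
def CoSmash₃.ι (X Y Z : C) : CoSmash₃ X Y Z ⟶ (X ⨿ Y) ⨿ Z := kernel.ι (comparison₃ X Y Z)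

theorem comparison₂_natural {X X' Y Y' : C} (f : X ⟶ X') (g : Y ⟶ Y') :
    comparison₂ X Y ≫ prod.map f g = coprod.map f g ≫ comparison₂ X' Y' := by
  ext <;> simp [comparison₂]

/-- Functoriality of the binary co-smash product: `f ⊗ g : X ⊗ Y ⟶ X' ⊗ Y'`. -/
def CoSmash₂.map {X X' Y Y' : C} (f : X ⟶ X') (g : Y ⟶ Y') : CoSmash₂ X Y ⟶ CoSmash₂ X' Y' :=
  kernel.map (comparison₂ X Y) (comparison₂ X' Y') (coprod.map f g) (prod.map f g)
    (comparison₂_natural f g)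

theorem CoSmash₂.map_ι {X X' Y Y' : C} (f : X ⟶ X') (g : Y ⟶ Y') :
    CoSmash₂.map f g ≫ CoSmash₂.ι X' Y' = CoSmash₂.ι X Y ≫ coprod.map f g := by
  exact kernel.lift_ι _ _ _

/-- The binary (Higgins) commutator `[K, L]` of subobjects `K`, `L` of `X`:
the image of `K ⊗ L ⟶ K + L ⟶ X`. -/
def commutator₂ {X : C} (K L : Subobject X) : Subobject X :=
  imageSubobject (CoSmash₂.ι (K : C) (L : C) ≫ coprod.desc K.arrow L.arrow)

/-- The ternary commutator `[K, L, M]` of subobjects `K`, `L`, `M` of `X`: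
the image of `K ⊗ L ⊗ M ⟶ K + L + M ⟶ X`. -/
def commutator₃ {X : C} (K L M : Subobject X) : Subobject X :=
  imageSubobject (CoSmash₃.ι (K : C) (L : C) (M : C) ≫
    coprod.desc (coprod.desc K.arrow L.arrow) M.arrow)

/-- The morphism `c^{X,X} = ∇ ∘ ι_{X,X} : X ⊗ X ⟶ X`. -/
def commutatorMorphism (X : C) : CoSmash₂ X X ⟶ X :=
  CoSmash₂.ι X X ≫ coprod.desc (𝟙 X) (𝟙 X)

theorem map_commutatorMorphism_comp {N X Q : C} (n : N ⟶ X) (q : X ⟶ Q) (w : n ≫ q = 0) :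
    (CoSmash₂.map n (𝟙 X) ≫ commutatorMorphism X) ≫ q = 0 := by
  have h0 : CoSmash₂.ι N X ≫ coprod.desc (0 : N ⟶ X) (𝟙 X) = 0 := by
    have h := kernel.condition (comparison₂ N X)
    have h' := congrArg (fun k => k ≫ prod.snd) h
    rw [zero_comp, Category.assoc, comparison₂, prod.lift_snd] at h'
    exact h'
  have h1 : coprod.desc n (𝟙 X) ≫ q = coprod.desc (0 : N ⟶ X) (𝟙 X) ≫ q := by
    ext <;> simp [w]
  calc (CoSmash₂.map n (𝟙 X) ≫ commutatorMorphism X) ≫ q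
      = (CoSmash₂.map n (𝟙 X) ≫ CoSmash₂.ι X X) ≫ coprod.desc (𝟙 X) (𝟙 X) ≫ q := by
        simp [commutatorMorphism]
    _ = CoSmash₂.ι N X ≫ coprod.desc n (𝟙 X) ≫ q := by
        rw [CoSmash₂.map_ι, Category.assoc, ← Category.assoc (coprod.map _ _)]
        simp
    _ = 0 := by
        rw [h1, ← Category.assoc, h0, zero_comp]

/-- The conjugation action `c^{N,X} : N ⊗ X ⟶ N` of `X` on a normal subobject `n : N ⟶ X`: the
unique morphism with `n ∘ c^{N,X} = c^{X,X} ∘ (n ⊗ 1)`. -/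
def conjugationAction {N X : C} (n : N ⟶ X) [NormalMono n] : CoSmash₂ N X ⟶ N :=
  (NormalMono.lift' n (CoSmash₂.map n (𝟙 X) ≫ commutatorMorphism X)
    (map_commutatorMorphism_comp n (NormalMono.g (f := n)) NormalMono.w)).1

theorem conjugationAction_comp {N X : C} (n : N ⟶ X) [NormalMono n] :
    conjugationAction n ≫ n = CoSmash₂.map n (𝟙 X) ≫ commutatorMorphism X :=
  (NormalMono.lift' n (CoSmash₂.map n (𝟙 X) ≫ commutatorMorphism X)
    (map_commutatorMorphism_comp n (NormalMono.g (f := n)) NormalMono.w)).2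

/-- The kernel of a morphism is a normal monomorphism. -/
instance normalMonoKernel {X Y : C} (f : X ⟶ Y) : NormalMono (kernel.ι f) where
  Z := Y
  g := f
  w := kernel.condition f
  isLimit := kernelIsKernel f

/-- The pullback `h^*(ψ) = ψ ∘ (1 ⊗ h)` of `ψ : A ⊗ G ⟶ A` along `h : H ⟶ G`. -/
def pullbackAction {A G H : C} (h : H ⟶ G) (ψ : CoSmash₂ A G ⟶ A) : CoSmash₂ A H ⟶ A :=
  CoSmash₂.map (𝟙 A) h ≫ ψ

end

/-- An internal reflexive graph `(R, G, d, c, e)`: `d` is the domain, `c` the codomain and `e` the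
identities morphism. -/
structure ReflexiveGraph (C : Type u) [Category.{v} C] where
  R : C
  G : C
  d : R ⟶ G
  c : R ⟶ G
  e : G ⟶ R
  e_d : e ≫ d = 𝟙 G
  e_c : e ≫ c = 𝟙 G

/-- A composition turning a reflexive graph into an internal category. The object of composable
pairs is the pullback of `d` and `c`, consisting of the pairs `(β, α)` with `d β = c α`, and
`m (β, α)` is the composite `β ∘ α`. Associativity is stated on generalised elements. -/
structure InternalCategoryStructure {C : Type u} [Category.{v} C] [HasPullbacks C]
    (𝒢 : ReflexiveGraph C) where
  m : pullback 𝒢.d 𝒢.c ⟶ 𝒢.R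
  m_d : m ≫ 𝒢.d = pullback.snd 𝒢.d 𝒢.c ≫ 𝒢.d
  m_c : m ≫ 𝒢.c = pullback.fst 𝒢.d 𝒢.c ≫ 𝒢.c
  comp_id : pullback.lift (𝟙 𝒢.R) (𝒢.d ≫ 𝒢.e)
    (by rw [Category.assoc, 𝒢.e_c, Category.comp_id, Category.id_comp]) ≫ m = 𝟙 𝒢.R
  id_comp : pullback.lift (𝒢.c ≫ 𝒢.e) (𝟙 𝒢.R)
    (by rw [Category.assoc, 𝒢.e_d, Category.comp_id, Category.id_comp]) ≫ m = 𝟙 𝒢.R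
  assoc : ∀ {T : C} (γ β α : T ⟶ 𝒢.R) (h₁ : γ ≫ 𝒢.d = β ≫ 𝒢.c) (h₂ : β ≫ 𝒢.d = α ≫ 𝒢.c),
    pullback.lift (pullback.lift γ β h₁ ≫ m) α
        (by rw [Category.assoc, m_d, pullback.lift_snd_assoc, h₂]) ≫ m =
      pullback.lift γ (pullback.lift β α h₂ ≫ m)
        (by rw [Category.assoc, m_c, pullback.lift_fst_assoc, h₁]) ≫ m

/-- A reflexive graph is an internal category when it admits a composition. -/
def IsInternalCategory {C : Type u} [Category.{v} C] [HasPullbacks C]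
    (𝒢 : ReflexiveGraph C) : Prop :=
  Nonempty (InternalCategoryStructure 𝒢)

end Homological

open Homological

namespace Homological

-- Write A = Ker d, K = Ker c and k : A → R for the inclusion. Everything hinges on the equation ⟨k,
-- 1⟩ ∘ ι = ⟨k, e c⟩ ∘ ι on A ⊗ R: conjugation of A by an arrow depends only on its codomain. Since
-- k is monic, this is condition 5.
--
-- A composition must satisfy m(a, 0) = a and m(e c x, x) = x. The object of composable pairs is a
-- point over R with kernel A, so these two families generate it by protomodularity: m is unique,
-- and the laws can be checked on generators (`isInternalCategory_of_hom`). The pairs form a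
-- quotient of A + R, and m exists once ⟨k, 1⟩ vanishes on the kernel of that quotient, which the
-- equation ensures.
--
-- Commutators enter because ⟨Ker c, e⟩ : K + G → R is a regular epimorphism, and the equation along
-- such a cover suffices (`isInternalCategory_of_action`). There A ⊗ (K + G) is generated by A ⊗ K,
-- A ⊗ G and A ⊗ K ⊗ G (`CoSmash₂.ι_desc_desc_eq`); the two sides agree on A ⊗ G, and the other two
-- pieces give the commutators.

attribute [local simp] prod.lift_fst prod.lift_snd prod.lift_fst_assoc prod.lift_snd_assoc
  coprod.inl_desc coprod.inr_desc coprod.inl_desc_assoc coprod.inr_desc_assoc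
  pullback.lift_fst pullback.lift_snd pullback.lift_fst_assoc pullback.lift_snd_assoc

/-! ### Split epimorphisms and protomodularity -/

section Points

variable {C : Type u} [Category.{v} C] [HasZeroMorphisms C] [HomologicalCategory C]

/-- In a homological category, a monomorphism into the total object of a point is invertible as
soon as the kernel and the section factor through it. -/
theorem isIso_of_mono_of_point {M X G : C} (p : X ⟶ G) (s : G ⟶ X) (hs : s ≫ p = 𝟙 G)
    (i : M ⟶ X) [Mono i] (a : kernel p ⟶ M) (ha : a ≫ i = kernel.ι p)
    (t : G ⟶ M) (ht : t ≫ i = s) : IsIso i := by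
  have h : PointHom (i ≫ p) t p s i (𝟙 G) := ⟨by simp, by simp [ht]⟩
  refine Protomodular.splitShortFive (i ≫ p) t p s i (𝟙 G) (by rw [← Category.assoc, ht, hs]) hs h
    inferInstance ⟨kernel.lift _ a ?_, ?_, ?_⟩
  · rw [← Category.assoc, ha, kernel.condition]
  · rw [← cancel_mono (kernel.ι _), ← cancel_mono i]
    simp [ha]
  · rw [← cancel_mono (kernel.ι _)]
    simp [ha]

/-- The kernel and the section of a point are jointly epic. -/
theorem point_hom_ext {X G Z : C} (p : X ⟶ G) (s : G ⟶ X) (hs : s ≫ p = 𝟙 G) {f g : X ⟶ Z}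
    (hk : kernel.ι p ≫ f = kernel.ι p ≫ g) (h : s ≫ f = s ≫ g) : f = g := by
  have := isIso_of_mono_of_point p s hs (equalizer.ι f g) (equalizer.lift _ hk)
    (equalizer.lift_ι _ _) (equalizer.lift _ h) (equalizer.lift_ι _ _)
  exact (cancel_epi (equalizer.ι f g)).1 (equalizer.condition f g)

/-- A morphism into the total object of a point is a regular epimorphism when the kernel factors
through it and the section does so after composition with a strong epimorphism. -/
theorem isRegularEpi_of_point {W X G H : C} (p : X ⟶ G) (s : G ⟶ X) (hs : s ≫ p = 𝟙 G)
    (q : W ⟶ X) (a : kernel p ⟶ W) (ha : a ≫ q = kernel.ι p) (h : H ⟶ G) [StrongEpi h]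
    (t : H ⟶ W) (ht : t ≫ q = h ≫ s) : IsRegularEpi q := by
  -- The image of `q` contains the kernel, and also the section by the lifting property of `h`
  -- against `F.m`; hence it is everything.
  let F := Regular.strongEpiMonoFactorisation q
  have sq : CommSq (t ≫ F.e) h F.m s := ⟨by simp [ht]⟩
  have : IsIso F.m := isIso_of_mono_of_point p s hs F.m (a ≫ F.e) (by simp [ha]) sq.lift
    sq.fac_right
  have : StrongEpi (F.e ≫ F.m) := strongEpi_comp _ _
  rw [F.fac] at this
  infer_instance

/-- A regular epimorphism is the cokernel of its kernel. -/
theorem exists_desc_of_isRegularEpi {X Y Z : C} (q : X ⟶ Y) [IsRegularEpi q] (f : X ⟶ Z)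
    (hf : kernel.ι q ≫ f = 0) : ∃ g : Y ⟶ Z, q ≫ g = f := by
  -- The kernel pair of `q` is a point via the diagonal, so its two composites with `f` need
  -- comparing only on the diagonal and on the kernel of a projection; the latter is carried into
  -- Ker q.
  refine ⟨_, (Cofork.IsColimit.desc' ((IsKernelPair.of_hasPullback q).toCoequalizer') f ?_).2⟩
  refine point_hom_ext (pullback.snd q q) (pullback.lift (𝟙 _) (𝟙 _) rfl) (by simp) ?_ (by simp)
  have h : (kernel.ι (pullback.snd q q) ≫ pullback.fst q q) ≫ q = 0 := by
    rw [Category.assoc, pullback.condition, ← Category.assoc, kernel.condition, zero_comp]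
  rw [← Category.assoc, ← Category.assoc, kernel.condition, zero_comp,
    ← kernel.lift_ι q _ h, Category.assoc, hf, comp_zero]

end Points

/-! ### Universal properties and functoriality of co-smash products -/

section CoSmash

variable {C : Type u} [Category.{v} C] [HasZeroMorphisms C] [HasFiniteColimits C]
  [HomologicalCategory C]

theorem CoSmash₂.ι_desc_zero_left (X : C) {Y Z : C} (g : Y ⟶ Z) :
    CoSmash₂.ι X Y ≫ coprod.desc 0 g = 0 := by
  have h : coprod.desc 0 g = comparison₂ X Y ≫ prod.snd ≫ g := by
    ext <;> simp [comparison₂]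
  rw [h, CoSmash₂.ι, kernel.condition_assoc, zero_comp]

theorem CoSmash₂.ι_desc_zero_right {X Z : C} (Y : C) (f : X ⟶ Z) :
    CoSmash₂.ι X Y ≫ coprod.desc f 0 = 0 := by
  have h : coprod.desc f 0 = comparison₂ X Y ≫ prod.fst ≫ f := by
    ext <;> simp [comparison₂]
  rw [h, CoSmash₂.ι, kernel.condition_assoc, zero_comp]

instance (X Y : C) : Mono (CoSmash₂.ι X Y) := inferInstanceAs (Mono (kernel.ι _))

/-- The universal property of `X ⊗ Y`. -/
theorem CoSmash₂.exists_lift {T X Y : C} (t : T ⟶ X ⨿ Y) (h₁ : t ≫ coprod.desc (𝟙 X) 0 = 0)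
    (h₂ : t ≫ coprod.desc 0 (𝟙 Y) = 0) : ∃ t' : T ⟶ CoSmash₂ X Y, t' ≫ CoSmash₂.ι X Y = t :=
  ⟨kernel.lift _ t (by ext <;> simp [comparison₂, h₁, h₂]), kernel.lift_ι _ _ _⟩

theorem CoSmash₂.map_ι_desc {X X' Y Y' Z : C} (f : X ⟶ X') (g : Y ⟶ Y') (a : X' ⟶ Z)
    (b : Y' ⟶ Z) : CoSmash₂.map f g ≫ CoSmash₂.ι X' Y' ≫ coprod.desc a b =
      CoSmash₂.ι X Y ≫ coprod.desc (f ≫ a) (g ≫ b) := by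
  rw [← Category.assoc, CoSmash₂.map_ι, Category.assoc, coprod.map_desc]

theorem CoSmash₂.map_comp {X X' X'' Y Y' Y'' : C} (f : X ⟶ X') (f' : X' ⟶ X'') (g : Y ⟶ Y')
    (g' : Y' ⟶ Y'') :
    CoSmash₂.map f g ≫ CoSmash₂.map f' g' = CoSmash₂.map (f ≫ f') (g ≫ g') := by
  rw [← cancel_mono (CoSmash₂.ι _ _), Category.assoc, CoSmash₂.map_ι, ← Category.assoc,
    CoSmash₂.map_ι, CoSmash₂.map_ι, Category.assoc, coprod.map_map]

theorem CoSmash₂.map_id (X Y : C) : CoSmash₂.map (𝟙 X) (𝟙 Y) = 𝟙 _ := by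
  rw [← cancel_mono (CoSmash₂.ι _ _), CoSmash₂.map_ι, coprod.map_id_id, Category.comp_id,
    Category.id_comp]

theorem CoSmash₂.map_zero_right {X X' : C} (f : X ⟶ X') (Y Y' : C) :
    CoSmash₂.map f (0 : Y ⟶ Y') = 0 := by
  rw [← cancel_mono (CoSmash₂.ι _ _), CoSmash₂.map_ι, zero_comp]
  have : coprod.map f (0 : Y ⟶ Y') = coprod.desc (f ≫ coprod.inl) 0 := by ext <;> simp
  rw [this, CoSmash₂.ι_desc_zero_right]

theorem CoSmash₃.ι_desc_zero_right {X Y W : C} (Z : C) (f : X ⟶ W) (g : Y ⟶ W) :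
    CoSmash₃.ι X Y Z ≫ coprod.desc (coprod.desc f g) 0 = 0 := by
  have h : coprod.desc (coprod.desc f g) 0 = comparison₃ X Y Z ≫ prod.fst ≫ coprod.desc f g := by
    ext <;> simp [comparison₃]
  rw [h, CoSmash₃.ι, kernel.condition_assoc, zero_comp]

theorem CoSmash₃.ι_desc_zero_middle {X Z W : C} (Y : C) (f : X ⟶ W) (g : Z ⟶ W) :
    CoSmash₃.ι X Y Z ≫ coprod.desc (coprod.desc f 0) g = 0 := by
  have h : coprod.desc (coprod.desc f 0) g =
      comparison₃ X Y Z ≫ prod.snd ≫ prod.fst ≫ coprod.desc f g := by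
    ext <;> simp [comparison₃]
  rw [h, CoSmash₃.ι, kernel.condition_assoc, zero_comp]

theorem CoSmash₃.ι_desc_zero_left {Y Z W : C} (X : C) (f : Y ⟶ W) (g : Z ⟶ W) :
    CoSmash₃.ι X Y Z ≫ coprod.desc (coprod.desc 0 f) g = 0 := by
  have h : coprod.desc (coprod.desc 0 f) g =
      comparison₃ X Y Z ≫ prod.snd ≫ prod.snd ≫ coprod.desc f g := by
    ext <;> simp [comparison₃]
  rw [h, CoSmash₃.ι, kernel.condition_assoc, zero_comp]

/-- The universal property of `X ⊗ Y ⊗ Z`. -/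
theorem CoSmash₃.exists_lift {T X Y Z : C} (t : T ⟶ (X ⨿ Y) ⨿ Z)
    (h₁ : t ≫ coprod.desc (coprod.desc coprod.inl coprod.inr) (0 : Z ⟶ X ⨿ Y) = 0)
    (h₂ : t ≫ coprod.desc (coprod.desc coprod.inl 0) (coprod.inr : Z ⟶ X ⨿ Z) = 0)
    (h₃ : t ≫ coprod.desc (coprod.desc 0 coprod.inl) (coprod.inr : Z ⟶ Y ⨿ Z) = 0) :
    ∃ t' : T ⟶ CoSmash₃ X Y Z, t' ≫ CoSmash₃.ι X Y Z = t := by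
  refine ⟨kernel.lift _ t ?_, kernel.lift_ι _ _ _⟩
  rw [comparison₃, prod.comp_lift, prod.comp_lift, h₁, h₂, h₃]
  ext <;> simp

/-- Functoriality of the ternary co-smash product: a vanishing ternary commutator still vanishes
after restriction along any three morphisms. -/
theorem CoSmash₃.ι_desc_of_eq_zero {X Y Z X' Y' Z' W : C} {f : X ⟶ W} {g : Y ⟶ W} {h : Z ⟶ W}
    (w : CoSmash₃.ι X Y Z ≫ coprod.desc (coprod.desc f g) h = 0)
    (x : X' ⟶ X) (y : Y' ⟶ Y) (z : Z' ⟶ Z) :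
    CoSmash₃.ι X' Y' Z' ≫ coprod.desc (coprod.desc (x ≫ f) (y ≫ g)) (z ≫ h) = 0 := by
  obtain ⟨t, ht⟩ := CoSmash₃.exists_lift
    (CoSmash₃.ι X' Y' Z' ≫ coprod.map (coprod.map x y) z)
    (by simpa using CoSmash₃.ι_desc_zero_right Z' (x ≫ coprod.inl) (y ≫ coprod.inr))
    (by simpa using CoSmash₃.ι_desc_zero_middle Y' (x ≫ coprod.inl) (z ≫ coprod.inr))
    (by simpa using CoSmash₃.ι_desc_zero_left X' (y ≫ coprod.inl) (z ≫ coprod.inr))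
  have := t ≫= w
  rw [← Category.assoc, ht] at this
  simpa using this

end CoSmash

/-! ### Generators of co-smash products -/

section Generation

variable {C : Type u} [Category.{v} C] [HasZeroMorphisms C] [HasFiniteColimits C]
  [HomologicalCategory C]

/-- The kernel of `X + Y ⟶ Y` is generated by `X` and `X ⊗ Y`. -/
theorem kernel_desc_hom_ext {X Y Z : C} {f g : X ⨿ Y ⟶ Z} (hl : coprod.inl ≫ f = coprod.inl ≫ g)
    (hι : CoSmash₂.ι X Y ≫ f = CoSmash₂.ι X Y ≫ g) :
    kernel.ι (coprod.desc (0 : X ⟶ Y) (𝟙 Y)) ≫ f =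
      kernel.ι (coprod.desc (0 : X ⟶ Y) (𝟙 Y)) ≫ g := by
  let n := kernel.ι (coprod.desc (0 : X ⟶ Y) (𝟙 Y))
  have hs : kernel.lift (coprod.desc (0 : X ⟶ Y) (𝟙 Y)) coprod.inl (by simp) ≫ n = coprod.inl :=
    kernel.lift_ι _ _ _
  -- The kernel of X + Y → Y retracts onto X, and what the retraction kills lies in X ⊗ Y.
  refine point_hom_ext (n ≫ coprod.desc (𝟙 X) 0) (kernel.lift _ coprod.inl (by simp)) ?_ ?_ ?_
  · rw [← Category.assoc, hs, coprod.inl_desc]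
  · obtain ⟨t, ht⟩ := CoSmash₂.exists_lift (kernel.ι (n ≫ coprod.desc (𝟙 X) 0) ≫ n)
      (by rw [Category.assoc, kernel.condition])
      (by rw [Category.assoc, kernel.condition, comp_zero])
    have := t ≫= hι
    rw [← Category.assoc, ← Category.assoc, ht] at this
    simpa using this
  · change _ ≫ n ≫ f = _ ≫ n ≫ g
    rw [← Category.assoc, ← Category.assoc, hs, hl]

/-- `X ⊗ (Y + Z)` is generated by `X ⊗ Y`, `X ⊗ Z` and `X ⊗ Y ⊗ Z`: a morphism out of `X + (Y + Z)`
agrees on it with the one obtained by killing `Y`, once it kills `X ⊗ Y` and `X ⊗ Y ⊗ Z`. -/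
theorem CoSmash₂.ι_desc_desc_eq {X Y Z W : C} {a : X ⟶ W} {b : Y ⟶ W} {c : Z ⟶ W}
    (h₂ : CoSmash₂.ι X Y ≫ coprod.desc a b = 0)
    (h₃ : CoSmash₃.ι X Y Z ≫ coprod.desc (coprod.desc a b) c = 0) :
    CoSmash₂.ι X (Y ⨿ Z) ≫ coprod.desc a (coprod.desc b c) =
      CoSmash₂.ι X (Y ⨿ Z) ≫ coprod.desc a (coprod.desc 0 c) := by
  let p : CoSmash₂ X (Y ⨿ Z) ⟶ CoSmash₂ X Z := CoSmash₂.map (𝟙 X) (coprod.desc 0 (𝟙 Z))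
  let p' : CoSmash₂ X (Y ⨿ Z) ⟶ CoSmash₂ X Y := CoSmash₂.map (𝟙 X) (coprod.desc (𝟙 Y) 0)
  let s' : CoSmash₂ X Y ⟶ CoSmash₂ X (Y ⨿ Z) := CoSmash₂.map (𝟙 X) coprod.inl
  have hs' : s' ≫ p = 0 := by
    simp only [s', p, CoSmash₂.map_comp, coprod.inl_desc, CoSmash₂.map_zero_right]
  have hsp : s' ≫ p' = 𝟙 _ := by
    simp only [s', p', CoSmash₂.map_comp, coprod.inl_desc, Category.comp_id, CoSmash₂.map_id]
  -- Two nested points: X ⊗ (Y + Z) over X ⊗ Z, and Ker p over X ⊗ Y. The part `y` killed by both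
  -- projections lands, after reassociating the sum, in X ⊗ Y ⊗ Z.
  refine point_hom_ext p (CoSmash₂.map (𝟙 X) coprod.inr) ?_ ?_ ?_
  · simp only [p, CoSmash₂.map_comp, coprod.inr_desc, Category.comp_id, CoSmash₂.map_id]
  · refine point_hom_ext (kernel.ι p ≫ p') (kernel.lift p s' hs') ?_ ?_ ?_
    · rw [kernel.lift_ι_assoc, hsp]
    · let y := kernel.ι (kernel.ι p ≫ p') ≫ kernel.ι p
      have hp : y ≫ p = 0 := by simp [y]
      have hp' : y ≫ p' = 0 := by simp only [y, Category.assoc, kernel.condition]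
      have hyZ {V : C} (a : X ⟶ V) (c : Z ⟶ V) :
          y ≫ CoSmash₂.ι X (Y ⨿ Z) ≫ coprod.desc a (coprod.desc 0 c) = 0 := by
        have := hp =≫ (CoSmash₂.ι X Z ≫ coprod.desc a c)
        simpa only [p, Category.assoc, CoSmash₂.map_ι_desc, zero_comp, Category.id_comp,
          coprod.desc_comp] using this
      have hyY {V : C} (a : X ⟶ V) (b : Y ⟶ V) :
          y ≫ CoSmash₂.ι X (Y ⨿ Z) ≫ coprod.desc a (coprod.desc b 0) = 0 := by
        have := hp' =≫ (CoSmash₂.ι X Y ≫ coprod.desc a b)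
        simpa only [p', Category.assoc, CoSmash₂.map_ι_desc, zero_comp, Category.id_comp,
          coprod.desc_comp] using this
      have hyX : y ≫ CoSmash₂.ι X (Y ⨿ Z) ≫ coprod.desc 0 (𝟙 (Y ⨿ Z)) = 0 := by
        rw [CoSmash₂.ι_desc_zero_left, comp_zero]
      have e : coprod.desc coprod.inl coprod.inr = 𝟙 (Y ⨿ Z) := by ext <;> simp
      obtain ⟨t, ht⟩ := CoSmash₃.exists_lift
        (y ≫ CoSmash₂.ι X (Y ⨿ Z) ≫ coprod.desc (coprod.inl ≫ coprod.inl)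
          (coprod.desc (coprod.inr ≫ coprod.inl) coprod.inr))
        (by simpa [coprod.desc_comp] using hyY coprod.inl coprod.inr)
        (by simpa [coprod.desc_comp] using hyZ coprod.inl coprod.inr)
        (by simpa [coprod.desc_comp, e] using hyX)
      have h := t ≫= h₃
      rw [← Category.assoc, ht] at h
      have h' : y ≫ CoSmash₂.ι X (Y ⨿ Z) ≫ coprod.desc a (coprod.desc b c) = 0 := by
        simpa [coprod.desc_comp] using h
      have := h'.trans (hyZ a c).symm
      simpa only [y, Category.assoc] using this
    · rw [kernel.lift_ι_assoc, kernel.lift_ι_assoc]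
      simp only [s', CoSmash₂.map_ι_desc, coprod.inl_desc, Category.id_comp, h₂,
        CoSmash₂.ι_desc_zero_right]
  · simp only [CoSmash₂.map_ι_desc, coprod.inr_desc]

/-- Converse of `CoSmash₂.ι_desc_desc_eq` for the ternary part. -/
theorem CoSmash₃.ι_desc_eq_zero {X Y Z W : C} {a : X ⟶ W} {b : Y ⟶ W} {c : Z ⟶ W}
    (h : CoSmash₂.ι X (Y ⨿ Z) ≫ coprod.desc a (coprod.desc b c) =
      CoSmash₂.ι X (Y ⨿ Z) ≫ coprod.desc a (coprod.desc 0 c)) :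
    CoSmash₃.ι X Y Z ≫ coprod.desc (coprod.desc a b) c = 0 := by
  -- Reassociation sends X ⊗ Y ⊗ Z into X ⊗ (Y + Z), where the right-hand side of `h` vanishes
  -- because it kills Y.
  obtain ⟨t, ht⟩ := CoSmash₂.exists_lift
    (CoSmash₃.ι X Y Z ≫ coprod.desc (coprod.desc coprod.inl (coprod.inl ≫ coprod.inr))
      (coprod.inr ≫ coprod.inr))
    (by simpa [coprod.desc_comp] using CoSmash₃.ι_desc_zero_right Z (𝟙 X) (0 : Y ⟶ X))
    (by simpa [coprod.desc_comp] using
      CoSmash₃.ι_desc_zero_left X (coprod.inl : Y ⟶ Y ⨿ Z) coprod.inr)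
  have := t ≫= h
  rw [← Category.assoc, ← Category.assoc, ht] at this
  simpa [coprod.desc_comp, CoSmash₃.ι_desc_zero_middle] using this

end Generation

/-! ### Composable pairs and compositions -/

section Graph

variable {C : Type u} [Category.{v} C] [HasZeroMorphisms C] [HomologicalCategory C]
  (𝒢 : ReflexiveGraph C)

namespace ReflexiveGraph

/-- The section `z ↦ (e (c (h z)), z)` of the projection of `R ×_G H` to `H`, for `h : H ⟶ R`. -/
noncomputable def pairSection {H : C} (h : H ⟶ 𝒢.R) : H ⟶ pullback 𝒢.d (h ≫ 𝒢.c) :=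
  pullback.lift (h ≫ 𝒢.c ≫ 𝒢.e) (𝟙 H) (by simp [𝒢.e_d])

/-- The inclusion `a ↦ (a, 0)` of the kernel of `d` in `R ×_G H`. -/
noncomputable def pairKernel {H : C} (h : H ⟶ 𝒢.G) : kernel 𝒢.d ⟶ pullback 𝒢.d h :=
  pullback.lift (kernel.ι 𝒢.d) 0 (by simp)

/-- The kernel of the second projection of `R ×_G H` factors through the kernel of `d`. -/
theorem exists_lift_pairKernel {H T : C} (h : H ⟶ 𝒢.G) (t : T ⟶ pullback 𝒢.d h)
    (ht : t ≫ pullback.snd 𝒢.d h = 0) : ∃ t', t' ≫ 𝒢.pairKernel h = t := by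
  refine ⟨kernel.lift _ (t ≫ pullback.fst _ _) ?_, ?_⟩
  · rw [Category.assoc, pullback.condition, ← Category.assoc, ht, zero_comp]
  · apply pullback.hom_ext <;> simp [pairKernel, ht]

theorem pullback_hom_ext {H Z : C} (h : H ⟶ 𝒢.G) (s : H ⟶ pullback 𝒢.d h)
    (hs : s ≫ pullback.snd 𝒢.d h = 𝟙 H) {f g : pullback 𝒢.d h ⟶ Z}
    (hk : 𝒢.pairKernel h ≫ f = 𝒢.pairKernel h ≫ g) (hsf : s ≫ f = s ≫ g) : f = g := by
  refine point_hom_ext (pullback.snd 𝒢.d h) s hs ?_ hsf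
  obtain ⟨t, ht⟩ := 𝒢.exists_lift_pairKernel h _ (kernel.condition (pullback.snd 𝒢.d h))
  rw [← ht, Category.assoc, hk, Category.assoc]

variable {𝒢} in
/-- A reflexive graph is an internal category as soon as there is a morphism out of the object of
composable pairs that is the identity on both copies of `R`'s generators: the remaining laws are
automatic. -/
theorem isInternalCategory_of_hom (m : pullback 𝒢.d 𝒢.c ⟶ 𝒢.R)
    (hk : 𝒢.pairKernel 𝒢.c ≫ m = kernel.ι 𝒢.d)
    (hs : pullback.lift (𝒢.c ≫ 𝒢.e) (𝟙 𝒢.R) (by simp [𝒢.e_d]) ≫ m = 𝟙 𝒢.R) :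
    IsInternalCategory 𝒢 := by
  -- On generalised elements: m(β, α) = α when β is the identity on c α, and `hk'` gives m(β, 0) =
  -- β.
  have hs' {T : C} (x : T ⟶ pullback 𝒢.d 𝒢.c)
      (h : x ≫ pullback.fst _ _ = x ≫ pullback.snd _ _ ≫ 𝒢.c ≫ 𝒢.e) :
      x ≫ m = x ≫ pullback.snd _ _ := by
    have : x = (x ≫ pullback.snd _ _) ≫
        pullback.lift (𝒢.c ≫ 𝒢.e) (𝟙 𝒢.R) (by simp [𝒢.e_d]) := by
      apply pullback.hom_ext <;> simp [h]
    conv_lhs => rw [this]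
    rw [Category.assoc _ _ m, hs, Category.comp_id]
  have hk' {T : C} (x : T ⟶ pullback 𝒢.d 𝒢.c) (h : x ≫ pullback.snd _ _ = 0) :
      x ≫ m = x ≫ pullback.fst _ _ := by
    obtain ⟨t, rfl⟩ := 𝒢.exists_lift_pairKernel _ _ h
    rw [Category.assoc, hk]
    simp [pairKernel]
  have m_d : m ≫ 𝒢.d = pullback.snd 𝒢.d 𝒢.c ≫ 𝒢.d := by
    refine 𝒢.pullback_hom_ext 𝒢.c
      (pullback.lift (𝒢.c ≫ 𝒢.e) (𝟙 𝒢.R) (by simp [𝒢.e_d])) (by simp) ?_ ?_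
    · rw [← Category.assoc, hk, kernel.condition]
      simp [pairKernel]
    · rw [← Category.assoc, hs]
      simp
  have m_c : m ≫ 𝒢.c = pullback.fst 𝒢.d 𝒢.c ≫ 𝒢.c := by
    refine 𝒢.pullback_hom_ext 𝒢.c
      (pullback.lift (𝒢.c ≫ 𝒢.e) (𝟙 𝒢.R) (by simp [𝒢.e_d])) (by simp) ?_ ?_
    · rw [← Category.assoc, hk]
      simp [pairKernel]
    · rw [← Category.assoc, hs]
      simp [𝒢.e_c]
  refine ⟨⟨m, m_d, m_c, ?_, hs, ?_⟩⟩
  · refine point_hom_ext 𝒢.d 𝒢.e 𝒢.e_d ?_ ?_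
    · exact (Category.assoc _ _ _).symm.trans ((hk' _ (by simp)).trans (by simp))
    · refine (Category.assoc _ _ _).symm.trans ((hs' _ ?_).trans ?_) <;>
        simp [reassoc_of% 𝒢.e_c, reassoc_of% 𝒢.e_d]
  · intro T γ β α h₁ h₂
    -- The pullback of `𝒢.d` and `c₃` is the object of composable triples (γ, (β, α)); `l` and `r`
    -- are the pairs (γβ, α) and (γ, βα). It is a point over the composable pairs, so associativity
    -- is checked on triples (a, 0, 0) and on triples with γ an identity.
    let c₃ := pullback.fst 𝒢.d 𝒢.c ≫ 𝒢.c
    let γβ : pullback 𝒢.d c₃ ⟶ pullback 𝒢.d 𝒢.c :=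
      pullback.lift (pullback.fst 𝒢.d c₃) (pullback.snd 𝒢.d c₃ ≫ pullback.fst 𝒢.d 𝒢.c)
        (by rw [pullback.condition, Category.assoc])
    let l : pullback 𝒢.d c₃ ⟶ pullback 𝒢.d 𝒢.c :=
      pullback.lift (γβ ≫ m) (pullback.snd 𝒢.d c₃ ≫ pullback.snd 𝒢.d 𝒢.c)
        (by simp [m_d, γβ, pullback.condition])
    let r : pullback 𝒢.d c₃ ⟶ pullback 𝒢.d 𝒢.c :=
      pullback.lift (pullback.fst 𝒢.d c₃) (pullback.snd 𝒢.d c₃ ≫ m)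
        (by rw [pullback.condition, Category.assoc, m_c])
    have key : l ≫ m = r ≫ m := by
      obtain ⟨s, hsf, hss⟩ : ∃ s : pullback 𝒢.d 𝒢.c ⟶ pullback 𝒢.d c₃,
          s ≫ pullback.fst _ _ = c₃ ≫ 𝒢.e ∧ s ≫ pullback.snd _ _ = 𝟙 _ :=
        ⟨pullback.lift (c₃ ≫ 𝒢.e) (𝟙 _) (by simp [𝒢.e_d]), by simp, by simp⟩
      refine 𝒢.pullback_hom_ext c₃ s hss ?_ ?_
      · rw [← Category.assoc, ← Category.assoc, hk' _ (by simp [l, pairKernel]),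
          hk' _ (by simp [r, pairKernel])]
        simp only [l, r, Category.assoc, pullback.lift_fst]
        rw [← Category.assoc, hk' _ (by simp [γβ, pairKernel])]
        simp [γβ]
      · rw [← Category.assoc, ← Category.assoc]
        have h₁ : s ≫ l = 𝟙 _ := by
          apply pullback.hom_ext
          · simp only [l, Category.assoc, pullback.lift_fst, Category.id_comp]
            rw [← Category.assoc, hs' _ (by simp [γβ, c₃, hsf, reassoc_of% hss])]
            simp [γβ, reassoc_of% hss]
          · simp [l, reassoc_of% hss]
        rw [h₁, Category.id_comp, hs' _ (by simp [r, c₃, reassoc_of% m_c, hsf, reassoc_of% hss])]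
        simp [r, reassoc_of% hss]
    have := pullback.lift γ (pullback.lift β α h₂) (by simp [c₃, h₁]) ≫= key
    refine Eq.trans ?_ (((Category.assoc _ _ _).trans this).trans
      ((Category.assoc _ _ _).symm.trans ?_)) <;> congr 1
    · apply pullback.hom_ext
      · simp only [l, Category.assoc, pullback.lift_fst]
        refine Eq.trans ?_ (Category.assoc _ _ _)
        congr 1
        apply pullback.hom_ext <;> simp [γβ]
      · simp [l]
    · apply pullback.hom_ext <;> simp [r]

/-! ### Actions, commutators and internal categories -/

variable [HasFiniteColimits C]

/-- If `A ⊗ H` acts on `A = Ker d` along a regular epimorphism `h : H ⟶ R` in the same way as along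
`e ∘ c ∘ h`, then the reflexive graph is an internal category. -/
theorem isInternalCategory_of_action {H : C} (h : H ⟶ 𝒢.R) [IsRegularEpi h]
    (w : CoSmash₂.ι (kernel 𝒢.d) H ≫ coprod.desc (kernel.ι 𝒢.d) h =
      CoSmash₂.ι (kernel 𝒢.d) H ≫ coprod.desc (kernel.ι 𝒢.d) (h ≫ 𝒢.c ≫ 𝒢.e)) :
    IsInternalCategory 𝒢 := by
  let s := 𝒢.pairSection h
  have hs : s ≫ pullback.snd 𝒢.d (h ≫ 𝒢.c) = 𝟙 H := by simp [s, pairSection]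
  let q := coprod.desc (𝒢.pairKernel (h ≫ 𝒢.c)) s
  have hq_fst : q ≫ pullback.fst _ _ = coprod.desc (kernel.ι 𝒢.d) (h ≫ 𝒢.c ≫ 𝒢.e) := by
    ext <;> simp [q, s, pairSection, pairKernel]
  have hq_snd : q ≫ pullback.snd _ _ = coprod.desc 0 (𝟙 H) := by
    ext <;> simp [q, s, pairSection, pairKernel]
  have hq : IsRegularEpi q := by
    obtain ⟨t, ht⟩ := 𝒢.exists_lift_pairKernel (h ≫ 𝒢.c) _ (kernel.condition (pullback.snd _ _))
    exact isRegularEpi_of_point _ s hs q (t ≫ coprod.inl) (by simp [q, ht]) (𝟙 H) coprod.inr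
      (by simp [q])
  -- Ker q lies in the kernel of A + H → H, where `w` makes ⟨k, h⟩ agree with ⟨k, h ≫ c ≫ e⟩. The
  -- latter factors through `q`, so it vanishes on Ker q.
  obtain ⟨m', hm'⟩ := exists_desc_of_isRegularEpi q (coprod.desc (kernel.ι 𝒢.d) h) (by
    have h₁ : kernel.ι q ≫ coprod.desc 0 (𝟙 H) = 0 := by
      rw [← hq_snd, ← Category.assoc, kernel.condition, zero_comp]
    have h₂ := kernel.lift _ _ h₁ ≫= kernel_desc_hom_ext (by simp) w
    rw [kernel.lift_ι_assoc, kernel.lift_ι_assoc] at h₂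
    rw [h₂, ← hq_fst, ← Category.assoc, kernel.condition, zero_comp])
  have hm'k : 𝒢.pairKernel (h ≫ 𝒢.c) ≫ m' = kernel.ι 𝒢.d := by
    simpa [q] using coprod.inl ≫= hm'
  have hm's : s ≫ m' = h := by
    simpa [q] using coprod.inr ≫= hm'
  let t : pullback 𝒢.d (h ≫ 𝒢.c) ⟶ pullback 𝒢.d 𝒢.c :=
    pullback.lift (pullback.fst _ _) (pullback.snd _ _ ≫ h) (by simp [pullback.condition])
  let s₀ : 𝒢.R ⟶ pullback 𝒢.d 𝒢.c :=
    pullback.lift (𝒢.c ≫ 𝒢.e) (𝟙 𝒢.R) (by simp [𝒢.e_d])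
  have htk : 𝒢.pairKernel (h ≫ 𝒢.c) ≫ t = 𝒢.pairKernel 𝒢.c := by
    apply pullback.hom_ext <;> simp [pairKernel, t]
  have hts : s ≫ t = h ≫ s₀ := by
    apply pullback.hom_ext <;> simp [s, pairSection, t, s₀]
  have ht : IsRegularEpi t := by
    obtain ⟨a, ha⟩ := 𝒢.exists_lift_pairKernel 𝒢.c _ (kernel.condition (pullback.snd _ _))
    exact isRegularEpi_of_point _ s₀ (by simp [s₀]) t (a ≫ 𝒢.pairKernel (h ≫ 𝒢.c))
      (by rw [Category.assoc, htk, ha]) h s hts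
  -- Elements of Ker t are pairs (0, z) with h z = 0. Such a pair is the value of `s` at z, so `m'`
  -- sends it to h z = 0.
  obtain ⟨m, hm⟩ := exists_desc_of_isRegularEpi t m' (by
    have h₁ : kernel.ι t ≫ pullback.fst _ _ = 0 := by
      have := kernel.condition t =≫ pullback.fst _ _
      rwa [zero_comp, Category.assoc, pullback.lift_fst] at this
    have h₂ : (kernel.ι t ≫ pullback.snd _ _) ≫ h = 0 := by
      have := kernel.condition t =≫ pullback.snd _ _
      rwa [zero_comp, Category.assoc, pullback.lift_snd, ← Category.assoc] at this
    have h₃ : kernel.ι t = (kernel.ι t ≫ pullback.snd _ _) ≫ s := by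
      apply pullback.hom_ext
      · rw [h₁, Category.assoc _ s]
        simp only [s, pairSection, pullback.lift_fst]
        rw [← Category.assoc, h₂, zero_comp]
      · rw [Category.assoc _ s, hs, Category.comp_id]
    rw [h₃, Category.assoc, hm's, h₂])
  refine isInternalCategory_of_hom m ?_ ?_
  · rw [← htk, Category.assoc, hm, hm'k]
  · rw [← cancel_epi h, ← Category.assoc, ← hts, Category.assoc, hm, hm's, Category.comp_id]

/-- In an internal category, `R` acts on `Ker d` through `e ∘ c`. -/
theorem action_eq_of_internalCategory (M : InternalCategoryStructure 𝒢) :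
    CoSmash₂.ι (kernel 𝒢.d) 𝒢.R ≫ coprod.desc (kernel.ι 𝒢.d) (𝟙 𝒢.R) =
      CoSmash₂.ι (kernel 𝒢.d) 𝒢.R ≫ coprod.desc (kernel.ι 𝒢.d) (𝒢.c ≫ 𝒢.e) := by
  let s : 𝒢.R ⟶ pullback 𝒢.d 𝒢.c :=
    pullback.lift (𝒢.c ≫ 𝒢.e) (𝟙 𝒢.R) (by simp [𝒢.e_d])
  let q := coprod.desc (𝒢.pairKernel 𝒢.c) s
  have hk : 𝒢.pairKernel 𝒢.c ≫ M.m = kernel.ι 𝒢.d := by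
    refine Eq.trans ?_ ((kernel.ι 𝒢.d ≫= M.comp_id).trans (Category.comp_id _))
    refine Eq.trans ?_ (Category.assoc _ _ _)
    congr 1
    apply pullback.hom_ext <;> simp [pairKernel]
  have hs : s ≫ M.m = 𝟙 _ := M.id_comp
  have hq_fst : q ≫ pullback.fst _ _ = coprod.desc (kernel.ι 𝒢.d) (𝒢.c ≫ 𝒢.e) := by
    ext <;> simp [q, s, pairKernel]
  have hq_snd : q ≫ pullback.snd _ _ = coprod.desc 0 (𝟙 𝒢.R) := by
    ext <;> simp [q, s, pairKernel]
  have hq_m : q ≫ M.m = coprod.desc (kernel.ι 𝒢.d) (𝟙 𝒢.R) := by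
    ext <;> simp [q, hs, hk]
  -- The image of A ⊗ R consists of pairs (a, 0), on which `M.m` and the first projection coincide.
  obtain ⟨t, ht⟩ := 𝒢.exists_lift_pairKernel 𝒢.c (CoSmash₂.ι (kernel 𝒢.d) 𝒢.R ≫ q)
    (by rw [Category.assoc, hq_snd, CoSmash₂.ι_desc_zero_left])
  rw [← hq_m, ← hq_fst, ← Category.assoc, ← Category.assoc, ← ht, Category.assoc, hk]
  simp [pairKernel]

variable {𝒢} in
theorem ι_desc_eq_of_action
    (w : CoSmash₂.ι (kernel 𝒢.d) 𝒢.R ≫ coprod.desc (kernel.ι 𝒢.d) (𝟙 𝒢.R) =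
      CoSmash₂.ι (kernel 𝒢.d) 𝒢.R ≫ coprod.desc (kernel.ι 𝒢.d) (𝒢.c ≫ 𝒢.e))
    {X Y : C} {f : X ⟶ 𝒢.R} (hf : f ≫ 𝒢.d = 0) (g : Y ⟶ 𝒢.R) :
    CoSmash₂.ι X Y ≫ coprod.desc f g = CoSmash₂.ι X Y ≫ coprod.desc f (g ≫ 𝒢.c ≫ 𝒢.e) := by
  simpa [CoSmash₂.map_ι_desc] using CoSmash₂.map (kernel.lift 𝒢.d f hf) g ≫= w

/-- Conjugation sees its second argument only through `c`, which kills Ker c: replacing the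
inclusion of Ker c by 0 changes nothing, whether on Ker c alone or inside Ker c + L. -/
theorem commutators_eq_zero_of_action
    (w : CoSmash₂.ι (kernel 𝒢.d) 𝒢.R ≫ coprod.desc (kernel.ι 𝒢.d) (𝟙 𝒢.R) =
      CoSmash₂.ι (kernel 𝒢.d) 𝒢.R ≫ coprod.desc (kernel.ι 𝒢.d) (𝒢.c ≫ 𝒢.e))
    (L : Subobject 𝒢.R) :
    commutator₂ (kernelSubobject 𝒢.d) (kernelSubobject 𝒢.c) = ⊥ ∧
      commutator₃ (kernelSubobject 𝒢.d) (kernelSubobject 𝒢.c) L = ⊥ := by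
  have hd := kernelSubobject_arrow_comp 𝒢.d
  have hc := kernelSubobject_arrow_comp 𝒢.c
  have h₂ : CoSmash₂.ι _ _ ≫
      coprod.desc (kernelSubobject 𝒢.d).arrow (kernelSubobject 𝒢.c).arrow = 0 := by
    rw [ι_desc_eq_of_action w hd, reassoc_of% hc, zero_comp, CoSmash₂.ι_desc_zero_right]
  have h₃ : CoSmash₃.ι _ _ _ ≫ coprod.desc
      (coprod.desc (kernelSubobject 𝒢.d).arrow (kernelSubobject 𝒢.c).arrow) L.arrow = 0 := by
    apply CoSmash₃.ι_desc_eq_zero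
    rw [ι_desc_eq_of_action w hd, coprod.desc_comp, reassoc_of% hc, zero_comp,
      ι_desc_eq_of_action w hd (coprod.desc 0 L.arrow), coprod.desc_comp, zero_comp]
  simp only [commutator₂, commutator₃, h₂, h₃, imageSubobject_zero, and_self]

/-- An image subobject vanishes only for the zero morphism. -/
theorem _root_.Homological.eq_zero_of_imageSubobject_eq_bot {X Y : C} {f : X ⟶ Y}
    (h : imageSubobject f = ⊥) : f = 0 := by
  rw [← imageSubobject_arrow_comp f]
  have : (imageSubobject f).arrow = 0 := by
    rw [h, Subobject.bot_arrow]
  rw [this, comp_zero]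

/-- Only the part of L coming from `e` matters, so L = R and L = Im e are treated together. -/
theorem isInternalCategory_of_commutators (L : Subobject 𝒢.R) (e' : 𝒢.G ⟶ (L : C))
    (he' : e' ≫ L.arrow = 𝒢.e)
    (h₂ : commutator₂ (kernelSubobject 𝒢.d) (kernelSubobject 𝒢.c) = ⊥)
    (h₃ : commutator₃ (kernelSubobject 𝒢.d) (kernelSubobject 𝒢.c) L = ⊥) :
    IsInternalCategory 𝒢 := by
  have w₂ := eq_zero_of_imageSubobject_eq_bot h₂
  have w₃ := eq_zero_of_imageSubobject_eq_bot h₃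
  have hd := kernelSubobject_arrow' 𝒢.d
  have hc := kernelSubobject_arrow' 𝒢.c
  have w₂' : CoSmash₂.ι (kernel 𝒢.d) (kernel 𝒢.c) ≫
      coprod.desc (kernel.ι 𝒢.d) (kernel.ι 𝒢.c) = 0 := by
    rw [← hd, ← hc, ← CoSmash₂.map_ι_desc, w₂, comp_zero]
  have w₃' : CoSmash₃.ι (kernel 𝒢.d) (kernel 𝒢.c) 𝒢.G ≫
      coprod.desc (coprod.desc (kernel.ι 𝒢.d) (kernel.ι 𝒢.c)) 𝒢.e = 0 := by
    rw [← hd, ← hc, ← he']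
    exact CoSmash₃.ι_desc_of_eq_zero w₃ _ _ _
  let h : kernel 𝒢.c ⨿ 𝒢.G ⟶ 𝒢.R := coprod.desc (kernel.ι 𝒢.c) 𝒢.e
  have : IsRegularEpi h :=
    isRegularEpi_of_point 𝒢.c 𝒢.e 𝒢.e_c h coprod.inl (by simp [h]) (𝟙 _) coprod.inr (by simp [h])
  refine 𝒢.isInternalCategory_of_action h ((CoSmash₂.ι_desc_desc_eq w₂' w₃').trans ?_)
  -- Killing Ker c in ⟨Ker c, e⟩ gives ⟨0, e⟩, which is `h ≫ c ≫ e`.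
  congr 2
  ext <;> simp [h, reassoc_of% 𝒢.e_c]

theorem conjugationAction_comp_kernel_ι :
    conjugationAction (kernel.ι 𝒢.d) ≫ kernel.ι 𝒢.d =
      CoSmash₂.ι (kernel 𝒢.d) 𝒢.R ≫ coprod.desc (kernel.ι 𝒢.d) (𝟙 𝒢.R) := by
  rw [conjugationAction_comp, commutatorMorphism, CoSmash₂.map_ι_desc, Category.comp_id,
    Category.comp_id]

theorem conjugationAction_eq_pullbackAction_iff :
    conjugationAction (kernel.ι 𝒢.d) =
        pullbackAction (𝒢.c ≫ 𝒢.e) (conjugationAction (kernel.ι 𝒢.d)) ↔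
      CoSmash₂.ι (kernel 𝒢.d) 𝒢.R ≫ coprod.desc (kernel.ι 𝒢.d) (𝟙 𝒢.R) =
        CoSmash₂.ι (kernel 𝒢.d) 𝒢.R ≫ coprod.desc (kernel.ι 𝒢.d) (𝒢.c ≫ 𝒢.e) := by
  rw [← cancel_mono (kernel.ι 𝒢.d), pullbackAction, Category.assoc,
    conjugationAction_comp_kernel_ι, CoSmash₂.map_ι_desc, Category.comp_id, Category.id_comp]

end ReflexiveGraph

end Graph
end Homological

theorem theorem5p1 {C : Type u} [Category.{v} C] [HasZeroMorphisms C] [HasFiniteColimits C]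
    [HomologicalCategory C]
  (𝒢 : ReflexiveGraph C) :
    List.TFAE
      [ IsInternalCategory 𝒢,
        commutator₂ (kernelSubobject 𝒢.d) (kernelSubobject 𝒢.c) = ⊥ ∧
          commutator₃ (kernelSubobject 𝒢.d) (kernelSubobject 𝒢.c) ⊤ = ⊥,
        commutator₂ (kernelSubobject 𝒢.d) (kernelSubobject 𝒢.c) = ⊥ ∧
          commutator₃ (kernelSubobject 𝒢.d) (kernelSubobject 𝒢.c) (imageSubobject 𝒢.e) = ⊥,
        ∃ φ : CoSmash₂ (kernel 𝒢.d) 𝒢.G ⟶ kernel 𝒢.d,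
          conjugationAction (kernel.ι 𝒢.d) = CoSmash₂.map (𝟙 (kernel 𝒢.d)) 𝒢.c ≫ φ,
        conjugationAction (kernel.ι 𝒢.d) =
          pullbackAction (𝒢.c ≫ 𝒢.e) (conjugationAction (kernel.ι 𝒢.d)) ] := by
  tfae_have 1 → 5 := fun ⟨M⟩ =>
    𝒢.conjugationAction_eq_pullbackAction_iff.2 (𝒢.action_eq_of_internalCategory M)
  tfae_have 5 → 2 := fun h =>
    𝒢.commutators_eq_zero_of_action (𝒢.conjugationAction_eq_pullbackAction_iff.1 h) _
  tfae_have 5 → 3 := fun h =>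
    𝒢.commutators_eq_zero_of_action (𝒢.conjugationAction_eq_pullbackAction_iff.1 h) _
  tfae_have 2 → 1 := fun ⟨h₂, h₃⟩ =>
    𝒢.isInternalCategory_of_commutators ⊤ (𝒢.e ≫ inv (⊤ : Subobject 𝒢.R).arrow) (by simp) h₂ h₃
  tfae_have 3 → 1 := fun ⟨h₂, h₃⟩ =>
    𝒢.isInternalCategory_of_commutators (imageSubobject 𝒢.e) (factorThruImageSubobject 𝒢.e)
      (imageSubobject_arrow_comp 𝒢.e) h₂ h₃
  tfae_have 5 → 4 := fun h =>
    ⟨CoSmash₂.map (𝟙 _) 𝒢.e ≫ conjugationAction (kernel.ι 𝒢.d), by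
      conv_lhs => rw [h]
      rw [pullbackAction, ← Category.assoc, CoSmash₂.map_comp, Category.comp_id]⟩
  -- An action factoring through `c` is unchanged by precomposition with `c ≫ e`, because `c ≫ e ≫ c
  -- = c`.
  tfae_have 4 → 5 := fun ⟨φ, h⟩ => by
    rw [h, pullbackAction, ← Category.assoc, CoSmash₂.map_comp, Category.comp_id, Category.assoc,
      𝒢.e_c, Category.comp_id]
  tfae_finish
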